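/- Let $n\ge 1$, $p\ge 0$ be integers, $h>0$, and let $\mathcal G$ be a weighted digraph on agents $1,\dots,n$ with weights $a_{ij}\ge 0$, $a_{ii}=0$, where there is a link from $j$ to $i$ exactly when $a_{ij}>0$. Let $L$ be its Laplacian, $L_{ii}=\sum_j a_{ij}$ and $L_{ij}=-a_{ij}$ for $j\ne i$. Suppose that $\mathcal G$ has a directed spanning tree, i.e. some agent reaches every other agent by a directed path. Let $\mathrm{sat}_h$ be the componentwise saturation function on $\mathbb R^p$ with level $[-h,h]$, and let $\alpha_i,\beta_i>0$ for $i=1,\dots,n$. Consider the event-triggered saturated system $$\dot x_i(t)=\mathrm{sat}_h(\hat u_i(t)),\qquad \hat u_i(t)=-\sum_{j=1}^n L_{ij}\,\hat x_j(t),\qquad t\ge 0,$$ with $x_i(t)\in\mathbb R^p$ (the derivative is a right derivative at the triggering times), where $\hat x_j(t)=x_j(t^j_k)$ for $t^j_k\le t<t^j_{k+1}$. Agent $i$ has triggering times $0=t^i_1<t^i_2<\cdots$ determined by the rule: having triggered at $t^i_k$, it holds the value $x_i(t^i_k)$ up to the largest time $t^i_{k+1}$ until which the bound $$\|x_i(t^i_k)-x_i(t)\|^2\le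 \alpha_i e^{-\beta_i t}$$ can be kept. That is, the bound holds on $[t^i_k,t^i_{k+1})$ and is attained with equality at $t=t^i_{k+1}$; if the bound is kept forever, there is no further event and $t^i_{k+1}=\infty$. (At a time at which the bound is attained but would not be exceeded immediately afterwards, the agent may either trigger or wait.) A closed-loop trajectory is considered up to the first time at which the triggering times of some agent accumulate, or for all $t\ge0$ if there is no such time. Then for every initial state $(x_1(0),\dots,x_n(0))$ a closed-loop trajectory exists, and for every closed-loop trajectory: (i) there is no Zeno behavior, i.e. no agent triggers infinitely often in a finite time interval (so the trajectory is defined for all $t\ge 0$); (ii) global consensus is achieved, i.e. there is $c\in\mathbb R^p$ with $\lim_{t\to\infty}x_i(t)=c$ for all $i$. -/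

import Mathlib

open Filter Topology

noncomputable section

/-- A weighted digraph on `n` agents: `adj i j = a_ij ≥ 0` is positive exactly when there is a link
from agent `j` to agent `i` (agent `j` sends information to agent `i`), and `a_ii = 0`. -/
structure WeightedDigraph (n : ℕ) where
  adj : Matrix (Fin n) (Fin n) ℝ
  adj_nonneg : ∀ i j, 0 ≤ adj i j
  adj_self : ∀ i, adj i i = 0

namespace WeightedDigraph

variable {n : ℕ}

/-- The Laplacian `L = D - A`, with `D` the diagonal matrix of the in-degrees `∑ j, a_ij`. -/
def laplacian (G : WeightedDigraph n) : Matrix (Fin n) (Fin n) ℝ :=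
  Matrix.diagonal (fun i => ∑ j, G.adj i j) - G.adj

/-- There is a link directed from agent `u` to agent `v`. -/
def Link (G : WeightedDigraph n) (u v : Fin n) : Prop := 0 < G.adj v u

/-- Some agent reaches every agent through a directed path. -/
def HasSpanningTree (G : WeightedDigraph n) : Prop :=
  ∃ r, ∀ v, Relation.ReflTransGen G.Link r v

end WeightedDigraph

/-- The scalar saturation function with saturation level `[-h, h]`. -/
def satScalar (h s : ℝ) : ℝ := if h ≤ s then h else if s ≤ -h then -h else s

/-- The saturation function on `ℝ^p`, componentwise. -/
def sat {p : ℕ} (h : ℝ) (s : EuclideanSpace ℝ (Fin p)) : EuclideanSpace ℝ (Fin p) :=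
  WithLp.toLp 2 (fun l => satScalar h (s l))

section ClosedLoop

variable {n p : ℕ}

/-- The index of the last triggering time up to time `t`. The sequence `τ` of triggering times of an
agent is numbered from `0`; the value `⊤` means that the event never happens. -/
def lastIndex (τ : ℕ → EReal) (t : ℝ) : ℕ := sSup {k : ℕ | τ k ≤ (t : EReal)}

/-- The state `x̂_i(t)` that agent `i` has sent most recently at time `t`. -/
def heldState (x : ℝ → Fin n → EuclideanSpace ℝ (Fin p)) (τ : Fin n → ℕ → EReal) (i : Fin n)
    (t : ℝ) : EuclideanSpace ℝ (Fin p) :=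
  x (τ i (lastIndex (τ i) t)).toReal i

/-- The event-triggered protocol `û_i(t) = - ∑ j, L_ij x̂_j(t)`. -/
def eventInput (G : WeightedDigraph n) (x : ℝ → Fin n → EuclideanSpace ℝ (Fin p))
    (τ : Fin n → ℕ → EReal) (i : Fin n) (t : ℝ) : EuclideanSpace ℝ (Fin p) :=
  -∑ j, G.laplacian i j • heldState x τ j t

/-- The end of the time interval on which the closed loop is defined: the first time at which the
triggering times of some agent accumulate, and `⊤` if there is no such time. -/
def accumulationTime (τ : Fin n → ℕ → EReal) : EReal := ⨅ i, ⨆ k, τ i k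

/-- `x` is a trajectory, with triggering times `τ i 0 = 0 < τ i 1 < …` of agent `i`, of the saturated
multi-agent system under the event-triggered protocol. It is only required to exist up to the first
accumulation of triggering times, so that Zeno behavior is not excluded by definition.

The last two fields are the triggering rule: after the event at `τ i k`, agent `i` waits as long as
`‖x_i(τ i k) - x_i(t)‖² ≤ α_i exp(-β_i t)` can be kept, so this bound holds throughout the waiting
time, and the event `τ i (k + 1)` happens at a time at which the bound is attained. (If agent `i`
does not wait further at such a time although it could, this is also allowed.) -/
structure IsExecution (G : WeightedDigraph n) (h : ℝ) (α β : Fin n → ℝ)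
    (x : ℝ → Fin n → EuclideanSpace ℝ (Fin p)) (τ : Fin n → ℕ → EReal) : Prop where
  trigger_zero : ∀ i, τ i 0 = 0
  trigger_mono : ∀ i, Monotone (τ i)
  trigger_lt : ∀ i k, τ i k < ⊤ → τ i k < τ i (k + 1)
  continuousOn : ∀ i, ContinuousOn (fun t => x t i)
    {t : ℝ | 0 ≤ t ∧ (t : EReal) < accumulationTime τ}
  /- The input is piecewise constant and continuous from the right, so the differential equation is
  stated with the right derivative (which is the derivative between events). -/
  dynamics : ∀ i (t : ℝ), 0 ≤ t → (t : EReal) < accumulationTime τ →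
    HasDerivWithinAt (fun s => x s i) (sat h (eventInput G x τ i t)) (Set.Ici t) t
  bound : ∀ i k (t : ℝ), τ i k ≤ (t : EReal) → (t : EReal) < τ i (k + 1) →
    (t : EReal) < accumulationTime τ →
    ‖x (τ i k).toReal i - x t i‖ ^ 2 ≤ α i * Real.exp (-(β i * t))
  event : ∀ i k, τ i (k + 1) < accumulationTime τ →
    ‖x (τ i k).toReal i - x (τ i (k + 1)).toReal i‖ ^ 2 =
      α i * Real.exp (-(β i * (τ i (k + 1)).toReal))

/-- No agent triggers infinitely often in a finite time interval. -/
def NoZeno (τ : Fin n → ℕ → EReal) : Prop :=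
  ∀ i (S : ℝ), {k : ℕ | τ i k ≤ (S : EReal)}.Finite

/-- The states of all agents converge to a common value. -/
def AchievesConsensus (x : ℝ → Fin n → EuclideanSpace ℝ (Fin p)) : Prop :=
  ∃ c : EuclideanSpace ℝ (Fin p), ∀ i, Tendsto (fun t => x t i) atTop (𝓝 c)

end ClosedLoop

end

/-! No Zeno behavior: saturation bounds every speed by `h√p`, while an event of agent `i` before a
finite time `T` requires a displacement of at least `√(α_i exp(-β_i T))`. Waiting times up to `T`
are thus bounded below, and events cannot accumulate at `T` (`accumulationTime_eq_top`).

Consensus: held and true states differ by an exponentially small error, so each coordinate follows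
the scalar saturated dynamics with a decaying perturbation inside the saturation
(`exists_isPerturbedFlow`). There the largest state plus the remaining integral of the perturbation
bound is a decreasing quantity `A`, with a limit `M`. On bounded states saturation is a gain between
some `κ > 0` and `1`, so gaps below `A` obey a linear differential inequality. The gap of the root
spreads along directed paths: after one time unit every agent, including the one then attaining the
maximum, is below `A` by a fixed fraction of that gap, up to a vanishing error (`exists_gap_lower`).
As `A` and the later maximum share the limit `M`, the gap of the root vanishes and the root tends to
`M`. By the symmetry `x ↦ -x` the root also tends to the limit of the minimum, so maximum and
minimum meet.

Existence: held values are constant between events, so the motion is affine up to the first time at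
which a bound is attained; the agents attaining it are reset and the construction is iterated. -/

/-! ### Scalar saturation. -/

section Saturation

variable {h : ℝ}

lemma satScalar_neg (hh : 0 < h) (s : ℝ) : satScalar h (-s) = -satScalar h s := by
  unfold satScalar
  split_ifs <;> linarith

lemma abs_satScalar_le (hh : 0 < h) (s : ℝ) : |satScalar h s| ≤ h := by
  unfold satScalar
  split_ifs <;> rw [abs_le] <;> constructor <;> linarith

lemma satScalar_zero (hh : 0 < h) : satScalar h 0 = 0 := by
  unfold satScalar
  split_ifs <;> linarith

lemma satScalar_mono (hh : 0 < h) : Monotone (satScalar h) := by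
  intro s r hsr
  unfold satScalar
  split_ifs <;> linarith

lemma satScalar_add_le (hh : 0 < h) (s w : ℝ) : satScalar h (s + w) ≤ satScalar h s + |w| := by
  have h1 := le_abs_self w
  have h2 := abs_nonneg w
  unfold satScalar
  split_ifs <;> linarith

/-- On bounded arguments the saturation is multiplication by a gain bounded away from zero. -/
lemma exists_gain_satScalar (hh : 0 < h) {s U : ℝ} (hs : |s| ≤ U) :
    ∃ k, h / (h + U) ≤ k ∧ k ≤ 1 ∧ satScalar h s = k * s := by
  have hU : 0 ≤ U := (abs_nonneg s).trans hs
  have h1 : h / (h + U) ≤ 1 := by rw [div_le_one (by linarith)]; linarith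
  rw [abs_le] at hs
  unfold satScalar
  split_ifs with h2 h3
  · have : 0 < s := by linarith
    refine ⟨h / s, ?_, ?_, ?_⟩
    · gcongr; linarith
    · rw [div_le_one this]; exact h2
    · field_simp
  · have : 0 < -s := by linarith
    refine ⟨h / -s, ?_, ?_, ?_⟩
    · gcongr; linarith
    · rw [div_le_one this]; linarith
    · have : s ≠ 0 := by linarith
      field_simp
  · exact ⟨1, h1, le_rfl, by ring⟩

end Saturation

/-! ### Consensus of scalar saturated dynamics under decaying perturbations. -/

/-- The scalar saturated consensus dynamics on `[0, ∞)`, whose input is perturbed by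
exponentially decaying terms `w`. -/
structure IsPerturbedFlow {n : ℕ} (G : WeightedDigraph n) (h C γ : ℝ) (x w : ℝ → Fin n → ℝ) :
    Prop where
  continuousOn : ∀ i, ContinuousOn (fun t => x t i) (Set.Ici 0)
  dynamics : ∀ i t, 0 ≤ t → HasDerivWithinAt (fun s => x s i)
    (satScalar h (∑ j, G.adj i j * (x t j - x t i) + w t i)) (Set.Ici t) t
  small : ∀ i t, 0 ≤ t → |w t i| ≤ C * Real.exp (-(γ * t))

/-- The largest coordinate. -/
noncomputable def maxCoord {n : ℕ} (r : Fin n) (v : Fin n → ℝ) : ℝ :=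
  Finset.univ.sup' ⟨r, Finset.mem_univ r⟩ v

lemma le_maxCoord {n : ℕ} (r : Fin n) (v : Fin n → ℝ) (i : Fin n) : v i ≤ maxCoord r v :=
  Finset.le_sup' v (Finset.mem_univ i)

lemma exists_eq_maxCoord {n : ℕ} (r : Fin n) (v : Fin n → ℝ) : ∃ i, maxCoord r v = v i := by
  obtain ⟨i, -, hi⟩ := Finset.exists_mem_eq_sup' ⟨r, Finset.mem_univ r⟩ v
  exact ⟨i, hi⟩

lemma hasDerivAt_exp_tail {C γ : ℝ} (hγ : 0 < γ) (c t : ℝ) :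
    HasDerivAt (fun t => c - C / γ * Real.exp (-(γ * t))) (C * Real.exp (-(γ * t))) t := by
  have h1 : HasDerivAt (fun t : ℝ => -(γ * t)) (-(γ * 1)) t :=
    ((hasDerivAt_id t).const_mul γ).neg
  have h2 := ((h1.exp).const_mul (C / γ)).const_sub c
  exact h2.congr_deriv (by field_simp)

namespace IsPerturbedFlow

variable {n : ℕ} {G : WeightedDigraph n} {h C γ : ℝ} {x w : ℝ → Fin n → ℝ}

lemma neg (hh : 0 < h) (H : IsPerturbedFlow G h C γ x w) :
    IsPerturbedFlow G h C γ (fun t i => -x t i) (fun t i => -w t i) where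
  continuousOn i := (H.continuousOn i).neg
  dynamics i t ht := by
    refine (H.dynamics i t ht).fun_neg.congr_deriv ?_
    rw [← satScalar_neg hh, neg_add, ← Finset.sum_neg_distrib]
    congr 2
    exact Finset.sum_congr rfl fun j _ => by ring
  small i t ht := by simpa using H.small i t ht

/-- At an agent attaining the maximum the coupling sum is nonpositive, so its velocity is at most
`|w| ≤ C exp(-γu)`, and the bound integrates this. The maximum need not be differentiable, hence the
comparison through right slopes; agents strictly below it stay below for a short time by continuity.
-/
lemma maxCoord_le (hh : 0 < h) (hγ : 0 < γ) (H : IsPerturbedFlow G h C γ x w) (r : Fin n)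
    {s t : ℝ} (hs : 0 ≤ s) (hst : s ≤ t) :
    maxCoord r (x t) ≤ maxCoord r (x s) + C / γ * Real.exp (-(γ * s))
      - C / γ * Real.exp (-(γ * t)) := by
  have hsub : Set.Icc s t ⊆ Set.Ici 0 := fun u hu => hs.trans hu.1
  have hd := hasDerivAt_exp_tail (C := C) hγ (maxCoord r (x s) + C / γ * Real.exp (-(γ * s)))
  refine image_le_of_liminf_slope_right_le_deriv_boundary (f := fun t => maxCoord r (x t))
    ?_ ?_ (fun u _ => (hd u).continuousAt.continuousWithinAt)
    (fun u _ => (hd u).hasDerivWithinAt) ?_ (Set.right_mem_Icc.2 hst)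
  · exact ContinuousOn.finset_sup'_apply _ fun i _ => (H.continuousOn i).mono hsub
  · simp
  · intro u hu ρ hρ
    have hu0 : 0 ≤ u := hs.trans hu.1
    have key : ∀ i, ∀ᶠ z in 𝓝[>] u, x z i < maxCoord r (x u) + ρ * (z - u) := by
      intro i
      rcases (le_maxCoord r (x u) i).lt_or_eq with hlt | heq
      · have h1 : Tendsto (fun z => x z i) (𝓝[>] u) (𝓝 (x u i)) :=
          ((H.continuousOn i).continuousWithinAt hu0).mono_left
            (nhdsWithin_mono _ fun z hz => hu0.trans (le_of_lt hz))
        have h2 : Tendsto (fun z => maxCoord r (x u) + ρ * (z - u)) (𝓝[>] u)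
            (𝓝 (maxCoord r (x u) + ρ * (u - u))) :=
          ((by fun_prop : Continuous fun z => maxCoord r (x u) + ρ * (z - u)).tendsto u).mono_left
            nhdsWithin_le_nhds
        exact h1.eventually_lt h2 (by simpa using hlt)
      · have hle : satScalar h (∑ j, G.adj i j * (x u j - x u i) + w u i) ≤
            C * Real.exp (-(γ * u)) := by
          have h1 : ∑ j, G.adj i j * (x u j - x u i) ≤ 0 := by
            refine Finset.sum_nonpos fun j _ => mul_nonpos_of_nonneg_of_nonpos
              (G.adj_nonneg i j) ?_
            rw [heq, sub_nonpos]
            exact le_maxCoord r _ j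
          have h2 := satScalar_mono hh h1
          rw [satScalar_zero hh] at h2
          linarith [satScalar_add_le hh (∑ j, G.adj i j * (x u j - x u i)) (w u i),
            H.small i u hu0]
        have h1 := (H.dynamics i u hu0).Ioi_of_Ici
        rw [hasDerivWithinAt_iff_tendsto_slope' (by simp)] at h1
        filter_upwards [h1.eventually_lt_const (hle.trans_lt hρ), self_mem_nhdsWithin] with z hz hzu
        have hzu : 0 < z - u := sub_pos.2 hzu
        rw [slope_def_field, div_lt_iff₀ hzu] at hz
        linarith
    refine Eventually.frequently ?_
    filter_upwards [eventually_all.2 key, self_mem_nhdsWithin] with z hz hzu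
    have hzu : 0 < z - u := sub_pos.2 hzu
    obtain ⟨i, hi⟩ := exists_eq_maxCoord r (x z)
    rw [slope_def_field, div_lt_iff₀ hzu, hi]
    linarith [hz i]

lemma antitoneOn_maxCoord (hh : 0 < h) (hγ : 0 < γ) (H : IsPerturbedFlow G h C γ x w)
    (r : Fin n) :
    AntitoneOn (fun t => maxCoord r (x t) + C / γ * Real.exp (-(γ * t))) (Set.Ici 0) := by
  intro s hs t _ hst
  have := H.maxCoord_le hh hγ r hs hst
  simp only
  linarith

lemma coeff_nonneg (H : IsPerturbedFlow G h C γ x w) (r : Fin n) : 0 ≤ C := by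
  have := (abs_nonneg _).trans (H.small r 0 le_rfl)
  simpa using this

lemma le_of_maxCoord (hh : 0 < h) (hγ : 0 < γ) (H : IsPerturbedFlow G h C γ x w) (r : Fin n)
    {s t : ℝ} (hs : 0 ≤ s) (hst : s ≤ t) (i : Fin n) :
    x t i ≤ maxCoord r (x s) + C / γ * Real.exp (-(γ * s)) := by
  have h1 := H.maxCoord_le hh hγ r hs hst
  have h2 : 0 ≤ C / γ * Real.exp (-(γ * t)) :=
    mul_nonneg (div_nonneg (H.coeff_nonneg r) hγ.le) (Real.exp_pos _).le
  linarith [le_maxCoord r (x t) i]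

/-- The bound on the maximum is applied to `x` and to `-x`. Boundedness is what keeps the saturation
gain away from zero. -/
lemma exists_abs_le (hh : 0 < h) (hγ : 0 < γ) (H : IsPerturbedFlow G h C γ x w) (r : Fin n) :
    ∃ B, 0 ≤ B ∧ ∀ i t, 0 ≤ t → |x t i| ≤ B := by
  refine ⟨|maxCoord r (x 0) + C / γ * Real.exp (-(γ * 0))| +
    |maxCoord r (fun i => -x 0 i) + C / γ * Real.exp (-(γ * 0))|, by positivity, ?_⟩
  intro i t ht
  have h1 := H.le_of_maxCoord hh hγ r le_rfl ht i
  have h2 := (H.neg hh).le_of_maxCoord hh hγ r le_rfl ht i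
  have h3 := le_abs_self (maxCoord r (x 0) + C / γ * Real.exp (-(γ * 0)))
  have h4 := le_abs_self (maxCoord r (fun i => -x 0 i) + C / γ * Real.exp (-(γ * 0)))
  have h5 := abs_nonneg (maxCoord r (x 0) + C / γ * Real.exp (-(γ * 0)))
  have h6 := abs_nonneg (maxCoord r (fun i => -x 0 i) + C / γ * Real.exp (-(γ * 0)))
  rw [abs_le]
  constructor <;> linarith

/-- The gap to an upper bound of the states satisfies a linear differential inequality. -/
lemma exists_gap_rate (hh : 0 < h) (hγ : 0 < γ) (H : IsPerturbedFlow G h C γ x w) (r : Fin n) :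
    ∃ K κ : ℝ, 0 ≤ K ∧ 0 < κ ∧ ∀ (A t : ℝ), 0 ≤ t → (∀ i, x t i ≤ A) → ∀ i j,
      satScalar h (∑ j, G.adj i j * (x t j - x t i) + w t i) ≤
        K * (A - x t i) - κ * (G.adj i j * (A - x t j)) + C * Real.exp (-(γ * t)) := by
  obtain ⟨B, hB, hxB⟩ := H.exists_abs_le hh hγ r
  set K := ∑ i, ∑ j, G.adj i j with hK
  have hrow : ∀ i, ∑ j, G.adj i j ≤ K := fun i =>
    Finset.single_le_sum (f := fun i => ∑ j, G.adj i j)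
      (fun i _ => Finset.sum_nonneg fun j _ => G.adj_nonneg i j) (Finset.mem_univ i)
  have hrow0 : ∀ i, 0 ≤ ∑ j, G.adj i j := fun i => Finset.sum_nonneg fun j _ => G.adj_nonneg i j
  have hK0 : 0 ≤ K := (hrow0 r).trans (hrow r)
  have hU : 0 < h + K * (2 * B) := by positivity
  -- `K`, the total weight, dominates every row sum; `K * (2 * B)` bounds every coupling sum, so the
  -- second constant is the smallest possible gain.
  refine ⟨K, h / (h + K * (2 * B)), hK0, div_pos hh hU, ?_⟩
  intro A t ht hA i j
  have habs : |∑ j, G.adj i j * (x t j - x t i)| ≤ K * (2 * B) := by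
    refine (Finset.abs_sum_le_sum_abs _ _).trans ?_
    calc ∑ j, |G.adj i j * (x t j - x t i)| ≤ ∑ j, G.adj i j * (2 * B) := by
          refine Finset.sum_le_sum fun j _ => ?_
          rw [abs_mul, abs_of_nonneg (G.adj_nonneg i j)]
          refine mul_le_mul_of_nonneg_left ?_ (G.adj_nonneg i j)
          linarith [abs_sub (x t j) (x t i), hxB i t ht, hxB j t ht]
      _ = (∑ j, G.adj i j) * (2 * B) := by rw [Finset.sum_mul]
      _ ≤ K * (2 * B) := mul_le_mul_of_nonneg_right (hrow i) (by positivity)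
  obtain ⟨k, hk1, hk2, hk3⟩ := exists_gain_satScalar hh habs
  have hk0 : 0 < k := (div_pos hh hU).trans_le hk1
  -- Relative to `A` the coupling is an upward pull from the agent's own gap minus a downward pull
  -- from its neighbours' gaps. The first is estimated with gain at most `1`, the second with gain
  -- at least `κ`, keeping only one neighbour.
  have hsplit : ∑ j, G.adj i j * (x t j - x t i) =
      (∑ j, G.adj i j) * (A - x t i) - ∑ j, G.adj i j * (A - x t j) := by
    rw [Finset.sum_mul, ← Finset.sum_sub_distrib]
    exact Finset.sum_congr rfl fun j _ => by ring
  have hterm : ∀ j, 0 ≤ G.adj i j * (A - x t j) := fun j =>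
    mul_nonneg (G.adj_nonneg i j) (sub_nonneg.2 (hA j))
  have h1 : G.adj i j * (A - x t j) ≤ ∑ j, G.adj i j * (A - x t j) :=
    Finset.single_le_sum (f := fun j => G.adj i j * (A - x t j)) (fun j _ => hterm j)
      (Finset.mem_univ j)
  have h2 : k * ((∑ j, G.adj i j) * (A - x t i)) ≤ K * (A - x t i) := by
    rw [← mul_assoc]
    refine mul_le_mul_of_nonneg_right ?_ (sub_nonneg.2 (hA i))
    calc k * ∑ j, G.adj i j ≤ 1 * ∑ j, G.adj i j := mul_le_mul_of_nonneg_right hk2 (hrow0 i)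
      _ ≤ K := by rw [one_mul]; exact hrow i
  have h3 : h / (h + K * (2 * B)) * (G.adj i j * (A - x t j)) ≤
      k * ∑ j, G.adj i j * (A - x t j) := mul_le_mul hk1 h1 (hterm j) hk0.le
  have h4 := satScalar_add_le hh (∑ j, G.adj i j * (x t j - x t i)) (w t i)
  have h5 := H.small i t ht
  rw [hk3] at h4
  refine h4.trans ?_
  rw [hsplit, mul_sub k]
  linarith

/-- If the root is away from an upper bound of the states, then after one time unit
every agent is. -/
lemma exists_gap_lower (hh : 0 < h) (hγ : 0 < γ) (H : IsPerturbedFlow G h C γ x w) {r : Fin n}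
    (hr : ∀ v, Relation.ReflTransGen G.Link r v) (i : Fin n) :
    ∃ b E : ℝ, 0 < b ∧ ∀ A t₀ : ℝ, 0 ≤ t₀ → (∀ i, ∀ t, t₀ ≤ t → x t i ≤ A) →
      b * (A - x t₀ r) - E * (C * Real.exp (-(γ * t₀))) ≤ A - x (t₀ + 1) i := by
  obtain ⟨K, κ, hK, hκ, hrate⟩ := H.exists_gap_rate hh hγ r
  have hC := H.coeff_nonneg r
  -- Comparison principle for the exponentially weighted gap.
  have step : ∀ i j (A t₀ : ℝ), 0 ≤ t₀ → (∀ i, ∀ t, t₀ ≤ t → x t i ≤ A) →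
      ∀ F F' : ℝ → ℝ, (∀ t, HasDerivAt F (F' t) t) → F t₀ ≤ A - x t₀ i →
      (∀ t, t₀ ≤ t → t ≤ t₀ + 1 → F' t ≤
        κ * G.adj i j * (Real.exp (K * (t - t₀)) * (A - x t j)) -
          Real.exp K * (C * Real.exp (-(γ * t₀)))) →
      ∀ t, t₀ ≤ t → t ≤ t₀ + 1 → F t ≤ Real.exp (K * (t - t₀)) * (A - x t i) := by
    intro i j A t₀ ht₀ hA F F' hF hF0 hFle t ht1 ht2
    have hexp : ∀ t, HasDerivAt (fun t => Real.exp (K * (t - t₀)))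
        (Real.exp (K * (t - t₀)) * (K * 1)) t := fun t =>
      (((hasDerivAt_id t).sub_const t₀).const_mul K).exp
    have hsub : Set.Icc t₀ (t₀ + 1) ⊆ Set.Ici 0 := fun u hu => ht₀.trans hu.1
    refine image_le_of_deriv_right_le_deriv_boundary
      (fun u _ => (hF u).continuousAt.continuousWithinAt) (fun u _ => (hF u).hasDerivWithinAt)
      (B := fun t => Real.exp (K * (t - t₀)) * (A - x t i)) ?_ ?_
      (fun u hu => ((hexp u).hasDerivWithinAt).mul
        ((H.dynamics i u (hsub ⟨hu.1, hu.2.le⟩)).const_sub A)) ?_ ⟨ht1, ht2⟩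
    · simpa using hF0
    · have hcont : ContinuousOn (fun t => Real.exp (K * (t - t₀))) (Set.Icc t₀ (t₀ + 1)) :=
        fun u _ => (hexp u).continuousAt.continuousWithinAt
      exact hcont.mul (continuousOn_const.sub ((H.continuousOn i).mono hsub))
    · intro u hu
      refine (hFle u hu.1 hu.2.le).trans ?_
      have h1 := hrate A u (ht₀.trans hu.1) (fun i => hA i u hu.1) i j
      have h2 : Real.exp (K * (u - t₀)) ≤ Real.exp K := by
        rw [Real.exp_le_exp]
        nlinarith [hu.2]
      have h3 : C * Real.exp (-(γ * u)) ≤ C * Real.exp (-(γ * t₀)) := by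
        gcongr; exact hu.1
      have h4 : Real.exp (K * (u - t₀)) * (C * Real.exp (-(γ * u))) ≤
          Real.exp K * (C * Real.exp (-(γ * t₀))) :=
        mul_le_mul h2 h3 (by positivity) (by positivity)
      have h5 := mul_le_mul_of_nonneg_left h1 (Real.exp_pos (K * (u - t₀))).le
      nlinarith [h4, h5]
  -- Induction along a path from the root: the weighted gap of `i` grows at least like `κ a_ij`
  -- times that of its predecessor `j`, so each link costs one integration and raises the power `d`
  -- by one. The constants do not depend on `A` and `t₀`, which allows `t₀ → ∞` later.
  have main : ∀ i, ∃ (b E : ℝ) (d : ℕ), 0 < b ∧ 0 ≤ E ∧ ∀ A t₀ : ℝ, 0 ≤ t₀ →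
      (∀ i, ∀ t, t₀ ≤ t → x t i ≤ A) → ∀ t, t₀ ≤ t → t ≤ t₀ + 1 →
      b * (A - x t₀ r) * (t - t₀) ^ d - E * (C * Real.exp (-(γ * t₀))) ≤
        Real.exp (K * (t - t₀)) * (A - x t i) := by
    intro i
    induction hr i with
    | refl =>
      refine ⟨1, Real.exp K, 0, one_pos, (Real.exp_pos _).le, ?_⟩
      intro A t₀ ht₀ hA t ht1 ht2
      -- Taking the root as its own neighbour makes the neighbour term vanish, since `a_rr = 0`.
      have h1 := step r r A t₀ ht₀ hA
        (fun t => (A - x t₀ r) - Real.exp K * (C * Real.exp (-(γ * t₀))) * (t - t₀))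
        (fun _ => -(Real.exp K * (C * Real.exp (-(γ * t₀))) * 1))
        (fun t => (((hasDerivAt_id t).sub_const t₀).const_mul _).const_sub _) (by simp)
        (fun u hu1 hu2 => by
          have : 0 ≤ κ * G.adj r r * (Real.exp (K * (u - t₀)) * (A - x u r)) := by
            rw [G.adj_self]; simp
          linarith) t ht1 ht2
      have h2 : 0 ≤ Real.exp K * (C * Real.exp (-(γ * t₀))) := by positivity
      nlinarith [h1, h2]
    | tail _ hlink ih =>
      rename_i j i _
      obtain ⟨b, E, d, hb, hE, ih⟩ := ih
      have ha : 0 < G.adj i j := hlink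
      -- The divisor `d + 1` comes from integrating `(t - t₀) ^ d`. The integrated error carries a
      -- factor `t - t₀ ≤ 1`, which is dropped at the end.
      refine ⟨κ * G.adj i j * b / (d + 1), κ * G.adj i j * E + Real.exp K, d + 1, by positivity,
        by positivity, ?_⟩
      intro A t₀ ht₀ hA t ht1 ht2
      have hpow : ∀ t, HasDerivAt (fun t : ℝ => (t - t₀) ^ (d + 1))
          (((d + 1 : ℕ) : ℝ) * (t - t₀) ^ d * 1) t := fun t =>
        ((hasDerivAt_id t).sub_const t₀).pow (d + 1)
      have h1 := step i j A t₀ ht₀ hA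
        (fun t => κ * G.adj i j * b / (d + 1) * (A - x t₀ r) * (t - t₀) ^ (d + 1) -
          (κ * G.adj i j * E + Real.exp K) * (C * Real.exp (-(γ * t₀))) * (t - t₀))
        (fun t => κ * G.adj i j * b / (d + 1) * (A - x t₀ r) *
            (((d + 1 : ℕ) : ℝ) * (t - t₀) ^ d * 1) -
          (κ * G.adj i j * E + Real.exp K) * (C * Real.exp (-(γ * t₀))) * 1)
        (fun t => ((hpow t).const_mul _).sub (((hasDerivAt_id t).sub_const t₀).const_mul _))
        (by simpa using hA i t₀ le_rfl)
        (fun u hu1 hu2 => by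
          have h2 := mul_le_mul_of_nonneg_left (ih A t₀ ht₀ hA u hu1 hu2)
            (mul_pos hκ ha).le
          have h3 : κ * G.adj i j * b / (d + 1) * (A - x t₀ r) *
            (((d + 1 : ℕ) : ℝ) * (u - t₀) ^ d * 1) =
              κ * G.adj i j * (b * (A - x t₀ r) * (u - t₀) ^ d) := by
            push_cast; field_simp
          rw [h3]
          linarith) t ht1 ht2
      have h2 : 0 ≤ (κ * G.adj i j * E + Real.exp K) * (C * Real.exp (-(γ * t₀))) := by
        positivity
      nlinarith [h1, h2]
  obtain ⟨b, E, d, hb, hE, hmain⟩ := main i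
  refine ⟨b / Real.exp K, E / Real.exp K, by positivity, ?_⟩
  intro A t₀ ht₀ hA
  have h1 := hmain A t₀ ht₀ hA (t₀ + 1) (by linarith) le_rfl
  have h2 : t₀ + 1 - t₀ = 1 := by ring
  rw [h2, one_pow, mul_one, mul_one] at h1
  have h3 : b / Real.exp K * (A - x t₀ r) - E / Real.exp K * (C * Real.exp (-(γ * t₀))) =
      (b * (A - x t₀ r) - E * (C * Real.exp (-(γ * t₀)))) / Real.exp K := by ring
  rw [h3, div_le_iff₀ (Real.exp_pos K)]
  linarith

lemma tendsto_exp_decay (hγ : 0 < γ) (c : ℝ) :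
    Tendsto (fun t : ℝ => c * Real.exp (-(γ * t))) atTop (𝓝 0) := by
  have h1 : Tendsto (fun t : ℝ => γ * t) atTop atTop := tendsto_id.const_mul_atTop hγ
  simpa using (Real.tendsto_exp_neg_atTop_nhds_zero.comp h1).const_mul c

/-- The largest state converges, and the root converges to the same limit. -/
lemma exists_tendsto_maxCoord (hh : 0 < h) (hγ : 0 < γ) (H : IsPerturbedFlow G h C γ x w)
    {r : Fin n} (hr : ∀ v, Relation.ReflTransGen G.Link r v) :
    ∃ M, Tendsto (fun t => maxCoord r (x t)) atTop (𝓝 M) ∧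
      Tendsto (fun t => x t r) atTop (𝓝 M) := by
  obtain ⟨B, hB, hxB⟩ := H.exists_abs_le hh hγ r
  have hC := H.coeff_nonneg r
  set A : ℝ → ℝ := fun t => maxCoord r (x t) + C / γ * Real.exp (-(γ * t)) with hAdef
  -- `A` is known to decrease only on `[0, ∞)`; the truncation makes it antitone on the whole line.
  have hanti : Antitone fun t => A (max t 0) := fun s t hst =>
    H.antitoneOn_maxCoord hh hγ r (Set.mem_Ici.2 (le_max_right s 0))
      (Set.mem_Ici.2 (le_max_right t 0))
      (max_le_max_right 0 hst)
  have hbdd : BddBelow (Set.range fun t => A (max t 0)) := by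
    refine ⟨-B, ?_⟩
    rintro _ ⟨t, rfl⟩
    have h1 := (abs_le.1 (hxB r (max t 0) (le_max_right _ _))).1
    have h2 : 0 ≤ C / γ * Real.exp (-(γ * max t 0)) := by positivity
    have h3 := le_maxCoord r (x (max t 0)) r
    simp only [hAdef]
    linarith
  obtain ⟨M, hM⟩ : ∃ M, Tendsto (fun t => A (max t 0)) atTop (𝓝 M) :=
    ⟨_, tendsto_atTop_ciInf hanti hbdd⟩
  have hA : Tendsto A atTop (𝓝 M) := by
    refine hM.congr' ?_
    filter_upwards [eventually_ge_atTop 0] with t ht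
    rw [max_eq_left ht]
  have hmax : Tendsto (fun t => maxCoord r (x t)) atTop (𝓝 M) := by
    have := hA.sub (tendsto_exp_decay hγ (C / γ))
    simpa [hAdef] using this
  refine ⟨M, hmax, ?_⟩
  choose b E hb hgap using H.exists_gap_lower hh hγ hr
  have hAx : ∀ t, 0 ≤ t → ∀ i s, t ≤ s → x s i ≤ A t := fun t ht i s hts =>
    H.le_of_maxCoord hh hγ r ht hts i
  -- An agent attaining the maximum at time `t + 1` controls the gap of the root at time `t`.
  have hlim : ∀ i, Tendsto (fun t => (A t - maxCoord r (x (t + 1)) +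
      E i * (C * Real.exp (-(γ * t)))) / b i) atTop (𝓝 0) := by
    intro i
    have h1 := (hA.sub (hmax.comp (tendsto_atTop_add_const_right atTop 1 tendsto_id))).add
      ((tendsto_exp_decay hγ C).const_mul (E i))
    simpa using h1.div_const (b i)
  -- The maximizing agent changes with `t`, so its bound is replaced by the sum of the absolute
  -- bounds over all agents.
  have hlim' := tendsto_finsetSum (Finset.univ : Finset (Fin n)) fun i _ => (hlim i).abs
  have hsq : Tendsto (fun t => A t - x t r) atTop (𝓝 0) := by
    refine squeeze_zero' ?_ ?_ (by simpa using hlim')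
    · filter_upwards [eventually_ge_atTop 0] with t ht
      exact sub_nonneg.2 (hAx t ht r t le_rfl)
    · filter_upwards [eventually_ge_atTop 0] with t ht
      obtain ⟨i, hi⟩ := exists_eq_maxCoord r (x (t + 1))
      have h1 := hgap i (A t) t ht (hAx t ht)
      rw [← hi] at h1
      have h2 : A t - x t r ≤ (A t - maxCoord r (x (t + 1)) +
          E i * (C * Real.exp (-(γ * t)))) / b i := by
        rw [le_div_iff₀ (hb i)]; linarith
      refine (h2.trans (le_abs_self _)).trans ?_
      exact Finset.single_le_sum (f := fun i => |(A t - maxCoord r (x (t + 1)) +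
        E i * (C * Real.exp (-(γ * t)))) / b i|) (fun i _ => abs_nonneg _) (Finset.mem_univ i)
  simpa using hA.sub hsq

/-- Scalar consensus of the perturbed saturated dynamics. -/
theorem exists_consensus (hh : 0 < h) (hγ : 0 < γ) (H : IsPerturbedFlow G h C γ x w)
    (hG : G.HasSpanningTree) : ∃ c, ∀ i, Tendsto (fun t => x t i) atTop (𝓝 c) := by
  obtain ⟨r, hr⟩ := hG
  obtain ⟨M, hM1, hM2⟩ := H.exists_tendsto_maxCoord hh hγ hr
  obtain ⟨m, hm1, hm2⟩ := (H.neg hh).exists_tendsto_maxCoord hh hγ hr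
  -- The root converges both to the limit of the maximum and to that of the minimum.
  have hMm : M = -m := tendsto_nhds_unique hM2 (by simpa using hm2.neg)
  refine ⟨M, fun i => tendsto_of_tendsto_of_tendsto_of_le_of_le (hMm ▸ hm1.neg) hM1 ?_ ?_⟩
  · intro t
    have := le_maxCoord r (fun i => -x t i) i
    simp only at this ⊢
    linarith
  · exact fun t => le_maxCoord r (x t) i

end IsPerturbedFlow

/-! ### Executions: exclusion of Zeno behavior and reduction to scalar flows. -/

lemma norm_sat_le {p : ℕ} {h : ℝ} (hh : 0 < h) (s : EuclideanSpace ℝ (Fin p)) :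
    ‖sat h s‖ ≤ √(p * h ^ 2) := by
  rw [EuclideanSpace.norm_eq]
  refine Real.sqrt_le_sqrt ?_
  calc ∑ l, ‖sat h s l‖ ^ 2 ≤ ∑ _l : Fin p, h ^ 2 := by
        refine Finset.sum_le_sum fun l _ => ?_
        exact pow_le_pow_left₀ (norm_nonneg _) (abs_satScalar_le hh (s l)) 2
    _ = p * h ^ 2 := by simp

lemma eventInput_apply {n p : ℕ} (G : WeightedDigraph n)
    (x : ℝ → Fin n → EuclideanSpace ℝ (Fin p)) (τ : Fin n → ℕ → EReal) (i : Fin n) (t : ℝ)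
    (l : Fin p) : eventInput G x τ i t l =
      ∑ j, G.adj i j * (heldState x τ j t l - heldState x τ i t l) := by
  simp only [eventInput, WeightedDigraph.laplacian, Matrix.sub_apply, PiLp.neg_apply,
    WithLp.ofLp_sum, Finset.sum_apply, PiLp.smul_apply, smul_eq_mul, sub_mul, mul_sub,
    Finset.sum_sub_distrib, Matrix.diagonal_apply, ite_mul, zero_mul, Finset.sum_ite_eq,
    Finset.mem_univ, if_true, Finset.sum_mul]
  ring

namespace IsExecution

variable {n p : ℕ} {G : WeightedDigraph n} {h : ℝ} {α β : Fin n → ℝ}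
  {x : ℝ → Fin n → EuclideanSpace ℝ (Fin p)} {τ : Fin n → ℕ → EReal}

/-- Before the accumulation time some `τ i K` exceeds `t`, so the set defining `lastIndex` is
bounded and its supremum is a genuine maximum rather than the default `0`. -/
lemma lastIndex_spec (H : IsExecution G h α β x τ) (i : Fin n) {t : ℝ} (ht : 0 ≤ t)
    (hacc : (t : EReal) < accumulationTime τ) :
    τ i (lastIndex (τ i) t) ≤ t ∧ (t : EReal) < τ i (lastIndex (τ i) t + 1) := by
  obtain ⟨K, hK⟩ := lt_iSup_iff.1 (hacc.trans_le (iInf_le _ i))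
  have hbdd : BddAbove {k : ℕ | τ i k ≤ (t : EReal)} :=
    ⟨K, fun k hk => le_of_not_gt fun hKk =>
      (hK.trans_le (H.trigger_mono i hKk.le)).not_ge hk⟩
  have hne : {k : ℕ | τ i k ≤ (t : EReal)}.Nonempty := by
    refine ⟨0, ?_⟩
    rw [Set.mem_ofPred_eq, H.trigger_zero i]
    exact_mod_cast ht
  refine ⟨Nat.sSup_mem hne hbdd, lt_of_not_ge fun hle => ?_⟩
  have : lastIndex (τ i) t + 1 ≤ lastIndex (τ i) t := le_csSup hbdd hle
  omega

lemma dist_le (hh : 0 < h) (H : IsExecution G h α β x τ) (i : Fin n) {s t : ℝ} (hs : 0 ≤ s)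
    (hst : s ≤ t) (hacc : (t : EReal) < accumulationTime τ) :
    ‖x t i - x s i‖ ≤ √(p * h ^ 2) * (t - s) := by
  have hlt : ∀ u ≤ t, (u : EReal) < accumulationTime τ := fun u hu =>
    lt_of_le_of_lt (EReal.coe_le_coe_iff.2 hu) hacc
  refine norm_image_sub_le_of_norm_deriv_right_le_segment (f := fun t => x t i)
    ((H.continuousOn i).mono fun u hu => ⟨hs.trans hu.1, hlt u hu.2⟩)
    (fun u hu => H.dynamics i u (hs.trans hu.1) (hlt u hu.2.le))
    (fun u _ => norm_sat_le hh _) t (Set.right_mem_Icc.2 hst)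

lemma accumulationTime_eq_top [Nonempty (Fin n)] (hh : 0 < h) (hα : ∀ i, 0 < α i)
    (hβ : ∀ i, 0 < β i) (H : IsExecution G h α β x τ) : accumulationTime τ = ⊤ := by
  by_contra hne
  obtain ⟨i, hi⟩ := exists_eq_ciInf_of_finite (f := fun i => ⨆ k, τ i k)
  change _ = accumulationTime τ at hi
  have hle : ∀ k, τ i k ≤ accumulationTime τ := fun k => hi ▸ le_iSup (τ i) k
  have hnonneg : ∀ k, 0 ≤ τ i k := fun k => H.trigger_zero i ▸ H.trigger_mono i (Nat.zero_le k)
  have htop : ∀ k, τ i k < ⊤ := fun k => (hle k).trans_lt (lt_top_iff_ne_top.2 hne)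
  have hlt : ∀ k, τ i k < accumulationTime τ := fun k =>
    (H.trigger_lt i k (htop k)).trans_le (hle (k + 1))
  have hcoe : ∀ k, ((τ i k).toReal : EReal) = τ i k := fun k =>
    EReal.coe_toReal (htop k).ne (ne_bot_of_le_ne_bot (by simp) (hnonneg k))
  set s : ℕ → ℝ := fun k => (τ i k).toReal with hs
  set T := (accumulationTime τ).toReal with hT
  have hTcoe : (T : EReal) = accumulationTime τ :=
    EReal.coe_toReal hne (ne_bot_of_le_ne_bot (by simp) ((hnonneg 0).trans (hle 0)))
  have hs0 : ∀ k, 0 ≤ s k := fun k => EReal.toReal_nonneg (hnonneg k)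
  have hsT : ∀ k, s k ≤ T := fun k => by
    rw [← EReal.coe_le_coe_iff, hTcoe, hcoe]; exact hle k
  have hsmono : ∀ k, s k ≤ s (k + 1) := fun k => by
    rw [← EReal.coe_le_coe_iff, hcoe, hcoe]; exact H.trigger_mono i k.le_succ
  set δ := √(α i * Real.exp (-(β i * T))) with hδ
  have hδ0 : 0 < δ := Real.sqrt_pos.2 (mul_pos (hα i) (Real.exp_pos _))
  -- Displacement at an event against maximal speed. The product form avoids dividing by `√(p * h ^
  -- 2)`, which is zero for `p = 0`.
  have hgap : ∀ k, δ ≤ √(p * h ^ 2) * (s (k + 1) - s k) := by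
    intro k
    have h1 := H.dist_le hh i (hs0 k) (hsmono k) (by rw [hcoe]; exact hlt (k + 1))
    have h2 := H.event i k (hlt (k + 1))
    refine le_trans ?_ h1
    rw [norm_sub_rev, hδ]
    refine Real.sqrt_le_iff.2 ⟨norm_nonneg _, ?_⟩
    rw [h2]
    have := hα i
    have := hβ i
    gcongr
    exact hsT (k + 1)
  have hsum : ∀ k : ℕ, k * δ ≤ √(p * h ^ 2) * s k := by
    intro k
    induction k with
    | zero =>
      rw [Nat.cast_zero, zero_mul]
      exact mul_nonneg (Real.sqrt_nonneg _) (hs0 0)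
    | succ k ih => push_cast; linarith [hgap k]
  obtain ⟨k, hk⟩ := Archimedean.arch (√(p * h ^ 2) * T + 1) hδ0
  rw [nsmul_eq_mul] at hk
  have := mul_le_mul_of_nonneg_left (hsT k) (Real.sqrt_nonneg (p * h ^ 2))
  linarith [hsum k]

lemma noZeno_of_accumulationTime_eq_top (H : IsExecution G h α β x τ)
    (htop : accumulationTime τ = ⊤) : NoZeno τ := by
  intro i S
  have hacc : (S : EReal) < accumulationTime τ := htop ▸ EReal.coe_lt_top S
  obtain ⟨K, hK⟩ := lt_iSup_iff.1 (hacc.trans_le (iInf_le _ i))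
  exact (Set.finite_Iio K).subset fun k hk => lt_of_not_ge fun hKk =>
    (hK.trans_le (H.trigger_mono i hKk)).not_ge hk

lemma norm_heldState_sub_sq_le (H : IsExecution G h α β x τ) (i : Fin n) {t : ℝ} (ht : 0 ≤ t)
    (hacc : (t : EReal) < accumulationTime τ) :
    ‖heldState x τ i t - x t i‖ ^ 2 ≤ α i * Real.exp (-(β i * t)) :=
  H.bound i _ t (H.lastIndex_spec i ht hacc).1 (H.lastIndex_spec i ht hacc).2 hacc

/-- Each coordinate of an execution is a perturbed scalar flow. -/
lemma exists_isPerturbedFlow [Nonempty (Fin n)] (hβ : ∀ i, 0 < β i)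
    (H : IsExecution G h α β x τ) (htop : accumulationTime τ = ⊤) (l : Fin p) :
    ∃ C γ w, 0 < γ ∧ IsPerturbedFlow G h C γ (fun t i => x t i l) w := by
  have hacc : ∀ t : ℝ, (t : EReal) < accumulationTime τ := fun t => htop ▸ EReal.coe_lt_top t
  obtain ⟨i₀, hi₀⟩ := Finite.exists_min β
  -- The triggering rule bounds a squared norm, so the square root halves the slowest rate.
  set γ := β i₀ / 2 with hγ
  set C₀ := ∑ i, √(α i) with hC₀
  set e : ℝ → Fin n → ℝ := fun t i => heldState x τ i t l - x t i l with he
  have herr : ∀ t, 0 ≤ t → ∀ i, |e t i| ≤ C₀ * Real.exp (-(γ * t)) := by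
    intro t ht i
    have h1 : |e t i| ≤ ‖heldState x τ i t - x t i‖ :=
      PiLp.norm_apply_le (heldState x τ i t - x t i) l
    have h2 : ‖heldState x τ i t - x t i‖ ≤ √(α i * Real.exp (-(β i * t))) :=
      Real.le_sqrt_of_sq_le (H.norm_heldState_sub_sq_le i ht (hacc t))
    have h3 : √(Real.exp (-(β i * t))) ≤ Real.exp (-(γ * t)) := by
      refine Real.sqrt_le_iff.2 ⟨(Real.exp_pos _).le, ?_⟩
      rw [← Real.exp_nat_mul, Real.exp_le_exp, hγ]
      push_cast
      nlinarith [hi₀ i]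
    have h4 : √(α i) ≤ C₀ := Finset.single_le_sum (f := fun i => √(α i))
      (fun i _ => Real.sqrt_nonneg _) (Finset.mem_univ i)
    rw [Real.sqrt_mul' _ (Real.exp_pos _).le] at h2
    exact h1.trans (h2.trans (mul_le_mul h4 h3 (Real.sqrt_nonneg _)
      ((Real.sqrt_nonneg _).trans h4)))
  have hrow : ∀ i, ∑ j, G.adj i j ≤ ∑ i, ∑ j, G.adj i j := fun i =>
    Finset.single_le_sum (f := fun i => ∑ j, G.adj i j)
      (fun i _ => Finset.sum_nonneg fun j _ => G.adj_nonneg i j) (Finset.mem_univ i)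
  -- The perturbation is the consensus input formed from the errors `e`.
  refine ⟨(∑ i, ∑ j, G.adj i j) * (2 * C₀), γ,
    fun t i => ∑ j, G.adj i j * (e t j - e t i), half_pos (hβ i₀), ?_, ?_, ?_⟩
  · intro i
    refine (EuclideanSpace.proj (𝕜 := ℝ) l).continuous.comp_continuousOn
      ((H.continuousOn i).mono fun t ht => ⟨ht, hacc t⟩)
  · intro i t ht
    have h1 := (EuclideanSpace.proj (𝕜 := ℝ) l).hasFDerivAt.comp_hasDerivWithinAt t
      (H.dynamics i t ht (hacc t))
    refine h1.congr_deriv ?_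
    change satScalar h (eventInput G x τ i t l) = _
    rw [eventInput_apply, ← Finset.sum_add_distrib]
    congr 1
    exact Finset.sum_congr rfl fun j _ => by simp only [he]; ring
  · intro i t ht
    refine (Finset.abs_sum_le_sum_abs _ _).trans ?_
    calc ∑ j, |G.adj i j * (e t j - e t i)|
        ≤ ∑ j, G.adj i j * (2 * C₀ * Real.exp (-(γ * t))) := by
          refine Finset.sum_le_sum fun j _ => ?_
          rw [abs_mul, abs_of_nonneg (G.adj_nonneg i j)]
          refine mul_le_mul_of_nonneg_left ?_ (G.adj_nonneg i j)
          linarith [abs_sub (e t j) (e t i), herr t ht i, herr t ht j]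
      _ = (∑ j, G.adj i j) * (2 * C₀ * Real.exp (-(γ * t))) := by rw [Finset.sum_mul]
      _ ≤ (∑ i, ∑ j, G.adj i j) * (2 * C₀ * Real.exp (-(γ * t))) := by
          have : 0 ≤ C₀ := Finset.sum_nonneg fun i _ => Real.sqrt_nonneg _
          exact mul_le_mul_of_nonneg_right (hrow i) (by positivity)
      _ = _ := by ring

lemma achievesConsensus [Nonempty (Fin n)] (hh : 0 < h) (hβ : ∀ i, 0 < β i)
    (hG : G.HasSpanningTree) (H : IsExecution G h α β x τ) (htop : accumulationTime τ = ⊤) :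
    AchievesConsensus x := by
  have hcoord : ∀ l, ∃ c, ∀ i, Tendsto (fun t => x t i l) atTop (𝓝 c) := by
    intro l
    obtain ⟨C, γ, w, hγ, hflow⟩ := H.exists_isPerturbedFlow hβ htop l
    exact hflow.exists_consensus hh hγ hG
  choose c hc using hcoord
  refine ⟨WithLp.toLp 2 c, fun i => ?_⟩
  have h1 : Tendsto (fun t => (fun l => x t i l)) atTop (𝓝 c) :=
    tendsto_pi_nhds.2 fun l => hc l i
  exact ((PiLp.continuous_toLp 2 (fun _ : Fin p => ℝ)).tendsto c).comp h1

end IsExecution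

/-! ### Existence of executions: construction by successive updates. -/

/-- The first time at which one of finitely many negative functions vanishes, waiting at most
one time unit. -/
lemma exists_first_zero {ι : Type*} [Finite ι] {g : ι → ℝ → ℝ} (hg : ∀ i, Continuous (g i))
    {s : ℝ} (hs : ∀ i, g i s < 0) :
    ∃ t, s < t ∧ (∀ i, ∀ u, s ≤ u → u ≤ t → g i u ≤ 0) ∧ (t = s + 1 ∨ ∃ i, g i t = 0) := by
  set Z : Set ℝ := Set.Icc s (s + 1) ∩ ⋃ i, {u | 0 ≤ g i u} with hZ
  have hclosed : IsClosed Z :=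
    isClosed_Icc.inter (isClosed_iUnion_of_finite fun i => isClosed_le continuous_const (hg i))
  have hnot : ∀ u, s ≤ u → u ≤ s + 1 → u ∉ Z → ∀ i, g i u < 0 := by
    intro u h1 h2 hu i
    by_contra hi
    exact hu ⟨⟨h1, h2⟩, Set.mem_iUnion.2 ⟨i, not_lt.1 hi⟩⟩
  rcases Z.eq_empty_or_nonempty with hempty | hne
  · refine ⟨s + 1, by linarith, fun i u h1 h2 => (hnot u h1 h2 ?_ i).le, Or.inl rfl⟩
    simp [hempty]
  · have hbdd : BddBelow Z := ⟨s, fun u hu => hu.1.1⟩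
    have hmem : sInf Z ∈ Z := hclosed.csInf_mem hne hbdd
    obtain ⟨⟨h1, h2⟩, hi⟩ := hmem
    obtain ⟨i, hi⟩ := Set.mem_iUnion.1 hi
    change 0 ≤ g i (sInf Z) at hi
    have hlt : s < sInf Z := by
      refine lt_of_le_of_ne h1 fun heq => ?_
      rw [← heq] at hi
      exact (hs i).not_ge hi
    have hbefore : ∀ j, ∀ u, s ≤ u → u < sInf Z → g j u < 0 := fun j u hu1 hu2 =>
      hnot u hu1 (by linarith) (notMem_of_lt_csInf hu2 hbdd) j
    have hat : ∀ j, g j (sInf Z) ≤ 0 := by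
      intro j
      refine le_of_tendsto (((hg j).tendsto (sInf Z)).mono_left
        (nhdsWithin_le_nhds (s := Set.Iio (sInf Z)))) ?_
      filter_upwards [Ioo_mem_nhdsLT hlt] with u hu
      exact (hbefore j u hu.1.le hu.2).le
    refine ⟨sInf Z, hlt, fun j u hu1 hu2 => ?_, Or.inr ⟨i, le_antisymm (hat i) hi⟩⟩
    rcases hu2.lt_or_eq with hu | rfl
    · exact (hbefore j u hu1 hu).le
    · exact hat j

/-- The state of the closed loop right after an update: positions and held values of the agents,
together with the time of the last event and the number of events of each agent so far. -/
structure LoopState (n p : ℕ) where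
  time : ℝ
  pos : Fin n → EuclideanSpace ℝ (Fin p)
  held : Fin n → EuclideanSpace ℝ (Fin p)
  last : Fin n → ℝ
  count : Fin n → ℕ

namespace LoopState

variable {n p : ℕ} (G : WeightedDigraph n) (h : ℝ) (α β : Fin n → ℝ)

/-- The constant velocity of agent `i` until the next update. -/
noncomputable def vel (S : LoopState n p) (i : Fin n) : EuclideanSpace ℝ (Fin p) :=
  sat h (-∑ j, G.laplacian i j • S.held j)

/-- The position of agent `i` if no update takes place until time `t`. -/
noncomputable def flow (S : LoopState n p) (i : Fin n) (t : ℝ) : EuclideanSpace ℝ (Fin p) :=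
  S.pos i + (t - S.time) • S.vel G h i

/-- No agent has attained its triggering bound. -/
def Safe (S : LoopState n p) : Prop :=
  ∀ i, ‖S.held i - S.pos i‖ ^ 2 < α i * Real.exp (-(β i * S.time))

/-- The closed loop runs from one update to the next one, which takes place when some agent
triggers, and after one time unit at the latest. -/
structure Step (S S' : LoopState n p) : Prop where
  time_lt : S.time < S'.time
  bound : ∀ i t, S.time ≤ t → t ≤ S'.time →
    ‖S.held i - S.flow G h i t‖ ^ 2 ≤ α i * Real.exp (-(β i * t))
  pos_eq : ∀ i, S'.pos i = S.flow G h i S'.time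
  agent : ∀ i, (‖S.held i - S'.pos i‖ ^ 2 = α i * Real.exp (-(β i * S'.time)) ∧
      S'.held i = S'.pos i ∧ S'.last i = S'.time ∧ S'.count i = S.count i + 1) ∨
    (S'.held i = S.held i ∧ S'.last i = S.last i ∧ S'.count i = S.count i)
  progress : S'.time = S.time + 1 ∨ ∃ i, S'.count i = S.count i + 1

variable {G h α β}

lemma flow_time (S : LoopState n p) (i : Fin n) : S.flow G h i S.time = S.pos i := by
  simp [flow]

lemma continuous_flow (S : LoopState n p) (i : Fin n) : Continuous (S.flow G h i) := by
  unfold flow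
  fun_prop

lemma hasDerivAt_flow (S : LoopState n p) (i : Fin n) (t : ℝ) :
    HasDerivAt (S.flow G h i) (S.vel G h i) t := by
  have := (((hasDerivAt_id t).sub_const S.time).smul_const (S.vel G h i)).const_add (S.pos i)
  rwa [one_smul] at this

/-- All agents attaining their bound are reset together, so their error is zero and below the
positive bound; the others are still strictly below. Safety is thus restored and the step can be
iterated. The cap of one time unit yields a next update even if nobody triggers again. -/
lemma exists_step (hα : ∀ i, 0 < α i) {S : LoopState n p} (hS : S.Safe α β) :
    ∃ S' : LoopState n p, Step G h α β S S' ∧ S'.Safe α β := by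
  classical
  set g : Fin n → ℝ → ℝ := fun i t =>
    ‖S.held i - S.flow G h i t‖ ^ 2 - α i * Real.exp (-(β i * t)) with hg
  have hgc : ∀ i, Continuous (g i) := fun i => by
    have := S.continuous_flow (G := G) (h := h) i
    simp only [hg]
    fun_prop
  obtain ⟨t, hst, hbound, hprog⟩ := exists_first_zero hgc (s := S.time) (fun i => by
    simp only [hg, flow_time]; exact sub_neg.2 (hS i))
  refine ⟨⟨t, fun i => S.flow G h i t, fun i => if g i t = 0 then S.flow G h i t else S.held i,
    fun i => if g i t = 0 then t else S.last i,
    fun i => if g i t = 0 then S.count i + 1 else S.count i⟩, ⟨hst, ?_, fun i => rfl, ?_, ?_⟩, ?_⟩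
  · exact fun i u h1 h2 => sub_nonpos.1 (hbound i u h1 h2)
  · intro i
    by_cases hi : g i t = 0
    · left
      simp only [hi, if_true]
      exact ⟨sub_eq_zero.1 hi, trivial, trivial, trivial⟩
    · right
      simp [hi]
  · refine hprog.imp id ?_
    rintro ⟨i, hi⟩
    exact ⟨i, by simp [hi]⟩
  · intro i
    by_cases hi : g i t = 0
    · simpa [hi] using mul_pos (hα i) (Real.exp_pos _)
    · simp only [hi, if_false]
      exact sub_neg.1 (lt_of_le_of_ne (hbound i t hst.le le_rfl) hi)

end LoopState

open LoopState

/-- A run of the closed loop through infinitely many updates, from fresh initial values. -/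
structure IsRun {n p : ℕ} (G : WeightedDigraph n) (h : ℝ) (α β : Fin n → ℝ)
    (S : ℕ → LoopState n p) : Prop where
  time_zero : (S 0).time = 0
  held_zero : (S 0).held = (S 0).pos
  last_zero : ∀ i, (S 0).last i = 0
  count_zero : ∀ i, (S 0).count i = 0
  step : ∀ m, Step G h α β (S m) (S (m + 1))

lemma exists_isRun {n p : ℕ} (G : WeightedDigraph n) (h : ℝ) {α β : Fin n → ℝ}
    (hα : ∀ i, 0 < α i) (x₀ : Fin n → EuclideanSpace ℝ (Fin p)) :
    ∃ S : ℕ → LoopState n p, IsRun G h α β S ∧ (S 0).pos = x₀ := by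
  have hnext : ∀ S : {S : LoopState n p // S.Safe α β},
      ∃ S' : {S : LoopState n p // S.Safe α β}, Step G h α β S.1 S'.1 := fun S => by
    obtain ⟨S', h1, h2⟩ := exists_step (G := G) (h := h) hα S.2
    exact ⟨⟨S', h2⟩, h1⟩
  choose next hnext using hnext
  have hinit : (⟨0, x₀, x₀, fun _ => 0, fun _ => 0⟩ : LoopState n p).Safe α β := fun i => by
    simpa using hα i
  refine ⟨fun m => (next^[m] ⟨_, hinit⟩).1, ⟨rfl, rfl, fun i => rfl, fun i => rfl, fun m => ?_⟩,
    rfl⟩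
  rw [Function.iterate_succ_apply']
  exact hnext _

section RunTrajectory

variable {n p : ℕ}

/-- The number of the last update up to time `t`. -/
noncomputable def runIndex (S : ℕ → LoopState n p) (t : ℝ) : ℕ := sSup {m | (S m).time ≤ t}

/-- The trajectory described by a run. -/
noncomputable def runState (G : WeightedDigraph n) (h : ℝ) (S : ℕ → LoopState n p) (t : ℝ)
    (i : Fin n) : EuclideanSpace ℝ (Fin p) :=
  (S (runIndex S t)).flow G h i t

/-- The triggering times described by a run. -/
noncomputable def runTrigger (S : ℕ → LoopState n p) (i : Fin n) (k : ℕ) : EReal :=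
  ⨅ (m) (_ : k ≤ (S m).count i), ((S m).time : EReal)

end RunTrajectory

namespace IsRun

variable {n p : ℕ} {G : WeightedDigraph n} {h : ℝ} {α β : Fin n → ℝ} {S : ℕ → LoopState n p}

lemma strictMono_time (R : IsRun G h α β S) : StrictMono fun m => (S m).time :=
  strictMono_nat_of_lt_succ fun m => (R.step m).time_lt

lemma time_nonneg (R : IsRun G h α β S) (m : ℕ) : 0 ≤ (S m).time :=
  R.time_zero ▸ R.strictMono_time.monotone (Nat.zero_le m)

lemma count_le_succ (R : IsRun G h α β S) (i : Fin n) (m : ℕ) :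
    (S m).count i ≤ (S (m + 1)).count i := by
  rcases (R.step m).agent i with ⟨-, -, -, h1⟩ | ⟨-, -, h1⟩ <;> omega

lemma monotone_count (R : IsRun G h α β S) (i : Fin n) : Monotone fun m => (S m).count i :=
  monotone_nat_of_le_succ (R.count_le_succ i)

lemma runIndex_eq (R : IsRun G h α β S) {m : ℕ} {t : ℝ} (h1 : (S m).time ≤ t)
    (h2 : t < (S (m + 1)).time) : runIndex S t = m := by
  refine IsGreatest.csSup_eq ⟨h1, fun k hk => ?_⟩
  have h3 : (S k).time < (S (m + 1)).time := lt_of_le_of_lt hk h2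
  exact Nat.lt_succ_iff.1 (R.strictMono_time.lt_iff_lt.1 h3)

/-- At an update time both adjacent affine pieces agree by `pos_eq`, so the right endpoint is
included; this gives continuity from the left. -/
lemma runState_eq (R : IsRun G h α β S) {m : ℕ} {t : ℝ} (h1 : (S m).time ≤ t)
    (h2 : t ≤ (S (m + 1)).time) (i : Fin n) : runState G h S t i = (S m).flow G h i t := by
  rcases h2.lt_or_eq with h3 | rfl
  · rw [runState, R.runIndex_eq h1 h3]
  · rw [runState, R.runIndex_eq le_rfl (R.step (m + 1)).time_lt, flow_time, (R.step m).pos_eq]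

lemma runState_time (R : IsRun G h α β S) (m : ℕ) (i : Fin n) :
    runState G h S (S m).time i = (S m).pos i := by
  rw [R.runState_eq le_rfl (R.step m).time_lt.le, flow_time]

lemma runTrigger_le {m k : ℕ} {i : Fin n} (hk : k ≤ (S m).count i) :
    runTrigger S i k ≤ (S m).time :=
  iInf₂_le m hk

lemma le_runTrigger (R : IsRun G h α β S) {m k : ℕ} {i : Fin n} (hk : (S m).count i < k) :
    ((S (m + 1)).time : EReal) ≤ runTrigger S i k := by
  refine le_iInf₂ fun m' hm' => EReal.coe_le_coe_iff.2 (R.strictMono_time.monotone ?_)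
  by_contra hlt
  have := R.monotone_count i (show m' ≤ m by omega)
  simp only at this
  omega

lemma runTrigger_zero (R : IsRun G h α β S) (i : Fin n) : runTrigger S i 0 = 0 := by
  refine le_antisymm ?_ (le_iInf₂ fun m _ => by exact_mod_cast R.time_nonneg m)
  have := runTrigger_le (S := S) (m := 0) (k := 0) (i := i) (Nat.zero_le _)
  rwa [R.time_zero] at this

/-- The bookkeeping invariant: the recorded `last` and `held` are the true last triggering time and
the state at it. It is preserved in both alternatives of `Step.agent`. -/
lemma runTrigger_count (R : IsRun G h α β S) (i : Fin n) (m : ℕ) :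
    runTrigger S i ((S m).count i) = ((S m).last i : EReal) ∧
      runState G h S ((S m).last i) i = (S m).held i := by
  induction m with
  | zero =>
    rw [R.count_zero, R.last_zero, R.runTrigger_zero, R.held_zero, ← R.runState_time 0 i,
      R.time_zero]
    exact ⟨rfl, rfl⟩
  | succ m ih =>
    rcases (R.step m).agent i with ⟨-, h1, h2, h3⟩ | ⟨h1, h2, h3⟩
    · rw [h1, h2]
      refine ⟨le_antisymm (runTrigger_le le_rfl) (R.le_runTrigger (by omega)), ?_⟩
      exact R.runState_time (m + 1) i
    · rw [h1, h2, h3]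
      exact ih

lemma runTrigger_le_iff (R : IsRun G h α β S) {m k : ℕ} {t : ℝ} (h1 : (S m).time ≤ t)
    (h2 : t < (S (m + 1)).time) (i : Fin n) :
    runTrigger S i k ≤ t ↔ k ≤ (S m).count i := by
  constructor
  · intro hk
    by_contra hlt
    have := (R.le_runTrigger (not_le.1 hlt)).trans hk
    exact h2.not_ge (EReal.coe_le_coe_iff.1 this)
  · exact fun hk => (runTrigger_le hk).trans (EReal.coe_le_coe_iff.2 h1)

lemma heldState_eq (R : IsRun G h α β S) {m : ℕ} {t : ℝ} (h1 : (S m).time ≤ t)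
    (h2 : t < (S (m + 1)).time) (i : Fin n) :
    heldState (runState G h S) (runTrigger S) i t = (S m).held i := by
  have hlast : lastIndex (runTrigger S i) t = (S m).count i :=
    IsGreatest.csSup_eq ⟨(R.runTrigger_le_iff h1 h2 i).2 le_rfl,
      fun k hk => (R.runTrigger_le_iff h1 h2 i).1 hk⟩
  rw [heldState, hlast, (R.runTrigger_count i m).1, EReal.toReal_coe, (R.runTrigger_count i m).2]

/-- The updates of a run only accumulate if the triggering times of some agent do. -/
lemma exists_lt_time (R : IsRun G h α β S) {t : ℝ}
    (hacc : (t : EReal) < accumulationTime (runTrigger S)) : ∃ m, t < (S m).time := by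
  by_contra! hle
  have hconv := tendsto_atTop_ciSup R.strictMono_time.monotone
    ⟨t, by rintro _ ⟨m, rfl⟩; exact hle m⟩
  have hdiff := (hconv.comp (tendsto_add_atTop_nat 1)).sub hconv
  rw [sub_self] at hdiff
  obtain ⟨N, hN⟩ := eventually_atTop.1 (hdiff.eventually_lt_const one_pos)
  -- Bounded update times have increments that are eventually below one, so each later update
  -- contains an event. Hence the total count is unbounded, and so is that of some agent, whose
  -- events all occur by time `t`.
  have hcount : ∀ k, k ≤ ∑ i, (S (N + k)).count i := by
    intro k
    induction k with
    | zero => exact Nat.zero_le _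
    | succ k ih =>
      refine Nat.succ_le_of_lt (ih.trans_lt (Finset.sum_lt_sum
        (fun i _ => R.count_le_succ i (N + k)) ?_))
      rcases (R.step (N + k)).progress with h1 | ⟨i, hi⟩
      · have h2 := hN (N + k) (by omega)
        simp only [Function.comp_apply] at h2
        linarith
      · exact ⟨i, Finset.mem_univ i, by rw [← add_assoc, hi]; omega⟩
  have hex : ∃ i, ∀ k, ∃ m, k ≤ (S m).count i := by
    by_contra! hbdd
    choose B hB using hbdd
    have h1 := hcount (∑ i, B i + 1)
    have h2 : ∑ i, (S (N + (∑ i, B i + 1))).count i ≤ ∑ i, B i :=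
      Finset.sum_le_sum fun i _ => (hB i _).le
    omega
  obtain ⟨i, hi⟩ := hex
  refine hacc.not_ge ((iInf_le _ i).trans (iSup_le fun k => ?_))
  obtain ⟨m, hm⟩ := hi k
  exact (runTrigger_le hm).trans (EReal.coe_le_coe_iff.2 (hle m))

lemma exists_mem_Ico (R : IsRun G h α β S) {t : ℝ} (ht : 0 ≤ t)
    (hacc : (t : EReal) < accumulationTime (runTrigger S)) :
    ∃ m, (S m).time ≤ t ∧ t < (S (m + 1)).time := by
  classical
  have hex := R.exists_lt_time hacc
  obtain ⟨m, hm⟩ : ∃ m, Nat.find hex = m + 1 := by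
    refine Nat.exists_eq_succ_of_ne_zero fun h0 => ?_
    have := Nat.find_spec hex
    rw [h0, R.time_zero] at this
    linarith
  exact ⟨m, not_lt.1 (Nat.find_min hex (by omega)), hm ▸ Nat.find_spec hex⟩

lemma exists_mem_Ioc (R : IsRun G h α β S) {t : ℝ} (ht : 0 < t)
    (hacc : (t : EReal) < accumulationTime (runTrigger S)) :
    ∃ m, (S m).time < t ∧ t ≤ (S (m + 1)).time := by
  obtain ⟨m, h1, h2⟩ := R.exists_mem_Ico ht.le hacc
  rcases h1.lt_or_eq with h3 | h3
  · exact ⟨m, h3, h2.le⟩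
  · cases m with
    | zero => rw [R.time_zero] at h3; linarith
    | succ m => exact ⟨m, h3 ▸ (R.step m).time_lt, h3.ge⟩

lemma hasDerivWithinAt_runState (R : IsRun G h α β S) {t : ℝ} (ht : 0 ≤ t)
    (hacc : (t : EReal) < accumulationTime (runTrigger S)) (i : Fin n) :
    HasDerivWithinAt (fun s => runState G h S s i)
      (sat h (eventInput G (runState G h S) (runTrigger S) i t)) (Set.Ici t) t := by
  obtain ⟨m, h1, h2⟩ := R.exists_mem_Ico ht hacc
  have hvel : sat h (eventInput G (runState G h S) (runTrigger S) i t) = (S m).vel G h i := by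
    simp only [eventInput, R.heldState_eq h1 h2, vel]
  rw [hvel]
  refine ((S m).hasDerivAt_flow i t).hasDerivWithinAt.congr_of_eventuallyEq ?_
    (R.runState_eq h1 h2.le i)
  filter_upwards [Ico_mem_nhdsGE h2] with u hu
  exact R.runState_eq (h1.trans hu.1) hu.2.le i

lemma continuousAt_runState (R : IsRun G h α β S) {t : ℝ} (ht : 0 < t)
    (hacc : (t : EReal) < accumulationTime (runTrigger S)) (i : Fin n) :
    ContinuousAt (fun s => runState G h S s i) t := by
  refine continuousAt_iff_continuous_left_right.2
    ⟨?_, (R.hasDerivWithinAt_runState ht.le hacc i).continuousWithinAt⟩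
  obtain ⟨m, h1, h2⟩ := R.exists_mem_Ioc ht hacc
  refine ((S m).continuous_flow i).continuousWithinAt.congr_of_eventuallyEq ?_
    (R.runState_eq h1.le h2 i)
  filter_upwards [Ioc_mem_nhdsLE h1] with u hu
  exact R.runState_eq hu.1.le (hu.2.trans h2) i

/-- The first update after which agent `i` has triggered `k` times is its `k`-th trigger. -/
lemma exists_first_count (R : IsRun G h α β S) {i : Fin n} {k : ℕ}
    (hk : runTrigger S i k < ⊤) :
    ∃ m, (S m).count i = k ∧ runTrigger S i k = (S m).time ∧
      ∀ m', m = m' + 1 → (S m').count i < k := by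
  classical
  -- Otherwise the infimum defining `runTrigger` is empty, hence `⊤`.
  have hex : ∃ m, k ≤ (S m).count i := by
    by_contra! hno
    refine hk.ne (iInf₂_eq_top.2 fun m hm => absurd hm (hno m).not_ge)
  have hspec := Nat.find_spec hex
  have hpred : ∀ m', Nat.find hex = m' + 1 → (S m').count i < k := fun m' hm' =>
    not_le.1 (Nat.find_min hex (by omega))
  refine ⟨Nat.find hex, ?_, ?_, hpred⟩
  · rcases hm : Nat.find hex with _ | m'
    · rw [hm, R.count_zero] at hspec
      rw [R.count_zero]; omega
    · have h1 := hpred m' hm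
      rw [hm] at hspec
      rcases (R.step m').agent i with ⟨-, -, -, h2⟩ | ⟨-, -, h2⟩ <;> omega
  · refine le_antisymm (runTrigger_le hspec) ?_
    rcases hm : Nat.find hex with _ | m'
    · rw [R.time_zero]
      exact le_iInf₂ fun m _ => by exact_mod_cast R.time_nonneg m
    · exact R.le_runTrigger (hpred m' hm)

theorem isExecution (R : IsRun G h α β S) :
    IsExecution G h α β (runState G h S) (runTrigger S) where
  trigger_zero := R.runTrigger_zero
  trigger_mono i k k' hk := le_iInf₂ fun _ hm => runTrigger_le (hk.trans hm)
  trigger_lt i k hk := by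
    obtain ⟨m, h1, h2, -⟩ := R.exists_first_count hk
    rw [h2]
    exact lt_of_lt_of_le (EReal.coe_lt_coe_iff.2 (R.step m).time_lt) (R.le_runTrigger (by omega))
  continuousOn i t ht := by
    rcases ht.1.lt_or_eq with h1 | rfl
    · exact (R.continuousAt_runState h1 ht.2 i).continuousWithinAt
    · exact (R.hasDerivWithinAt_runState le_rfl ht.2 i).continuousWithinAt.mono fun u hu => hu.1
  dynamics i t ht hacc := R.hasDerivWithinAt_runState ht hacc i
  bound i k t h1 h2 hacc := by
    have ht : 0 ≤ t := by
      have h3 : runTrigger S i 0 ≤ runTrigger S i k :=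
        le_iInf₂ fun _ hm => runTrigger_le (k.zero_le.trans hm)
      rw [R.runTrigger_zero] at h3
      exact_mod_cast h3.trans h1
    obtain ⟨m, h3, h4⟩ := R.exists_mem_Ico ht hacc
    -- Event `k` has occurred by time `t` and event `k + 1` has not, so `k` is the current count.
    have hk : k = (S m).count i := by
      have h5 := (R.runTrigger_le_iff h3 h4 i).1 h1
      have h6 := mt (R.runTrigger_le_iff h3 h4 (k := k + 1) i).2 h2.not_ge
      omega
    rw [hk, (R.runTrigger_count i m).1, EReal.toReal_coe, (R.runTrigger_count i m).2,
      R.runState_eq h3 h4.le]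
    exact (R.step m).bound i t h3 h4.le
  event i k hk := by
    obtain ⟨m, h1, h2, h3⟩ := R.exists_first_count (hk.trans_le le_top)
    cases m with
    | zero => rw [R.count_zero] at h1; omega
    -- Update `m + 1` is the first with count `k + 1`, so agent `i` triggers in this very step and
    -- attains its bound there.
    | succ m =>
      have h4 := h3 m rfl
      rcases (R.step m).agent i with ⟨h5, -, -, h6⟩ | ⟨-, -, h6⟩
      · have h7 : k = (S m).count i := by omega
        rw [h2, EReal.toReal_coe, R.runState_time, h7, (R.runTrigger_count i m).1,
          EReal.toReal_coe, (R.runTrigger_count i m).2]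
        exact h5
      · omega

end IsRun

theorem exists_isExecution {n p : ℕ} (G : WeightedDigraph n) (h : ℝ) {α β : Fin n → ℝ}
    (hα : ∀ i, 0 < α i) (x₀ : Fin n → EuclideanSpace ℝ (Fin p)) :
    ∃ x τ, IsExecution G h α β x τ ∧ x 0 = x₀ := by
  obtain ⟨S, R, hS⟩ := exists_isRun (β := β) G h hα x₀
  refine ⟨_, _, R.isExecution, ?_⟩
  funext i
  rw [← hS, ← R.runState_time 0 i, R.time_zero]

theorem theorem4 {n p : ℕ} (G : WeightedDigraph n) (hG : G.HasSpanningTree) (h : ℝ) (hh : 0 < h)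
    (α β : Fin n → ℝ) (hα : ∀ i, 0 < α i) (hβ : ∀ i, 0 < β i) :
    (∀ x₀ : Fin n → EuclideanSpace ℝ (Fin p), ∃ x τ, IsExecution G h α β x τ ∧ x 0 = x₀) ∧
    ∀ (x : ℝ → Fin n → EuclideanSpace ℝ (Fin p)) (τ : Fin n → ℕ → EReal),
      IsExecution G h α β x τ → NoZeno τ ∧ AchievesConsensus x := by
  have : Nonempty (Fin n) := hG.nonempty
  refine ⟨fun x₀ => exists_isExecution G h hα x₀, fun x τ H => ?_⟩
  have htop := H.accumulationTime_eq_top hh hα hβ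
  exact ⟨H.noZeno_of_accumulationTime_eq_top htop, H.achievesConsensus hh hβ hG htop⟩
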